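/- Let $\mathbf{C}$ be an adhesive category (with all pullbacks) in which every morphism factors as an epimorphism followed by a monomorphism, which has a strict initial object, and which is finitary (every object has finitely many subobjects). Let $\mathbb{T}\in\{DPO,SqPO\}$. *Rules and applications.* A linear rule $r=(O\leftarrow K\rightarrow I)$ is a span of monomorphisms. A $\mathbb{T}$-type application of $r$ to $X$ along a mono $m:I\to X$ consists of a complement $K\to K'\xrightarrow{d}X$ of $K\to I\xrightarrow{m}X$ (a pushout complement for $DPO$, a final pullback complement for $SqPO$) followed by the pushout $O\xrightarrow{m^*}Y\xleftarrow{d^*}K'$ of $O\leftarrow K\to K'$. A $DPO^\dagger$-type application along a mono $n:O\to Y$ consists of a pushout complement $K\to K'\to Y$ of $K\to O\to Y$ followed by the pushout $I\to X\leftarrow K'$ of $I\leftarrow K\to K'$. Any span $r=(Y\leftarrow K'\to X)$ in the bottom row of an application is written $Y\Leftarrow X$. *Setting.* Let $r_j=(O_j\leftarrow K_j\to I_j)$ $(j=1,2)$ be linear rules. Let $r_1$ be applied ($\mathbb{T}$-type) to $X_0$ along $m_1:I_1\to X_0$, with complement $K_1'$, maps $d_1:K_1'\to X_0$, $d_1^*:K_1'\to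 X_1$ and comatch $m_1^*:O_1\to X_1$; and then $r_2$ to $X_1$ along $m_2:I_2\to X_1$, with complement $K_2'$ and $d_2:K_2'\to X_1$. The applications are *sequentially independent* if there are monomorphisms $n_1:O_1\to K_2'$, $n_2:I_2\to K_1'$ with $d_2\circ n_1=m_1^*$ and $d_1^*\circ n_2=m_2$. Let $I_2\leftarrow M_{21}\to O_1$ be the pullback of $I_2\xrightarrow{m_2}X_1\xleftarrow{m_1^*}O_1$. A *composite diagram* consists of the pushout $I_2\to N_{21}\leftarrow O_1$ of this span, a $\mathbb{T}$-type application of $r_2$ along $I_2\to N_{21}$ with bottom span $O_{21}\leftarrow\overline K_2\to N_{21}$, and a $DPO^\dagger$-type application of $r_1$ along $O_1\to N_{21}$ with bottom span $N_{21}\leftarrow\overline K_1\to I_{21}$. *Conditions.* Conditions over $X$ are built inductively from $\mathsf{true}$, $\exists(a:X\to A,c_A)$ with $a$ mono, negation and (small) conjunction. A mono $m:X\to Y$ satisfies $\exists(a,c_A)$ iff $m=q\circ a$ for a mono $q:A\to Y$ satisfying $c_A$; the other clauses are the logical ones. For $a_1:A\to B_1$, $\mathsf{Shift}(a_1,\cdot)$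 commutes with the logical operations and $\mathsf{Shift}(a_1,\exists(a_2:A\to B_2,c))=\bigvee\exists(e_1:B_1\to E,\mathsf{Shift}(e_2:B_2\to E,c))$, over all isomorphism classes of spans of monos $B_1\xleftarrow{b_1}D\xrightarrow{b_2}B_2$ through which $(a_1,a_2)$ factors, with pushout $(e_1,e_2)$. For a rule $r=(O\leftarrow K\to I)$, $\mathsf{Trans}(r,\cdot)$ commutes with the logical operations, and $\mathsf{Trans}(r,\exists(b:O\to B,c))$ is $\mathsf{false}$ if there is no $DPO^\dagger$-type application of $r$ along $b$, and otherwise is $\exists(b^*:I\to B',\mathsf{Trans}(B\Leftarrow B',c))$ for that application. For conditions $c_{I_1},c_{I_2}$ over $I_1,I_2$ put $$c_{I_{21}}=\mathsf{Shift}(I_1\to I_{21},c_{I_1})\wedge\mathsf{Trans}(N_{21}\Leftarrow I_{21},\mathsf{Shift}(I_2\to N_{21},c_{I_2})).$$ **Claim.** A composite diagram exists, and for every composite diagram the following hold. 1. The two applications are sequentially independent if and only if there are monomorphisms $O_1\to\overline K_2$ and $I_2\to\overline K_1$ such that $$(O_1\to\overline K_2\to N_{21})=(O_1\to N_{21})\quad\text{and}\quad(I_2\to\overline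 K_1\to N_{21})=(I_2\to N_{21}).$$ 2. If such monomorphisms exist, $M_{21}\to O_1$ and $M_{21}\to I_2$ lift to $M_{21}\to K_1$ and $M_{21}\to K_2$, and the span $I_1\leftarrow K_1\leftarrow M_{21}\to K_2\to O_2$ admits a composite diagram for $r_1$ after $r_2$. In it, the map $I_1\to N_{12}$ factors through the complement $\overline{\overline K}_2$ of its $DPO^\dagger$-type application of $r_2$, which gives a map $I_1\to\overline{\overline K}_2\to I_{12}$; and there is an isomorphism $I_{12}\cong I_{21}$ compatible with the maps from $I_1$ and from $I_2$ (where $I_2\to I_{21}$ is $I_2\to\overline K_1\to I_{21}$). Let $c_{I_{12}}$ be the corresponding condition with the roles of the rules exchanged. 3. For rules with conditions $R_j=(r_j,c_{I_j})$, the following are equivalent. (a) The two applications are sequentially independent and the conditions are compatible with switching: for every $\mathbb{T}$-type application of $r_1$ and then $r_2$, to any object $Y$, with the same overlap span $I_2\leftarrow M_{21}\to O_1$ (again a pullback), and every $\mathbb{T}$-type application of $r_2$ and then $r_1$ to $Y$ that is a switch of it, the matches of the first sequence satisfy $c_{I_1},c_{I_2}$ if and only if the matches of the second do. Here a sequence applying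 $r_2$ along $m_2':I_2\to Y$ and then $r_1$ along $m_1'$ is a switch of a sequence applying $r_1$ along $m_1:I_1\to Y$ and then $r_2$ along $m_2$ if there is a map from $I_2$ to the complement of the first application of $r_1$ through which both $m_2$ and $m_2'$ factor, and a map from $I_1$ to the complement of the first application of $r_2$ (in the switched sequence) through which both $m_1$ and $m_1'$ factor. (b) Monomorphisms as in 1. exist, and $c_{I_{21}}\,\dot\equiv_{\mathbb T}\,c_{I_{12}}$: for every choice of the opposite composite as in 2. and every $m:I_{21}\to Y$ which is a $\mathbb{T}$-admissible match of both composite rules (that is, $N_{21}\Leftarrow I_{21}$ can be applied along $m$ and then $O_{21}\Leftarrow N_{21}$ along the resulting comatch, and likewise for the opposite composite and $I_{12}\cong I_{21}\xrightarrow{m}Y$), $m$ satisfies $c_{I_{21}}$ if and only if $I_{12}\cong I_{21}\xrightarrow{m}Y$ satisfies $c_{I_{12}}$. -/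

import Mathlib

open CategoryTheory CategoryTheory.Limits

universe v u

namespace Rewriting

variable {C : Type u} [Category.{v} C]

/-! ### Standing assumptions on the category -/

/-- Every morphism factors as an epimorphism followed by a monomorphism. -/
def HasEpiMonoFactorization (C : Type u) [Category.{v} C] : Prop :=
  ∀ {X Y : C} (f : X ⟶ Y), ∃ (I : C) (e : X ⟶ I) (m : I ⟶ Y), Epi e ∧ Mono m ∧ e ≫ m = f

/-- Every object has only finitely many subobjects. -/
def IsFinitary (C : Type u) [Category.{v} C] : Prop :=
  ∀ X : C, Finite (Subobject X)

/-! ### Linear rules and rule applications -/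

/-- A linear rule `O ←o- K -i→ I` with output interface `O` and input interface `I`:
a span of monomorphisms. -/
structure Rule (O I : C) where
  K : C
  o : K ⟶ O
  i : K ⟶ I
  mono_o : Mono o
  mono_i : Mono i

attribute [instance] Rule.mono_o Rule.mono_i

/-- `(b, d)` is a final pullback complement of the composable pair `(c, m)`:
```
      c
  K -----> I
  |        |
b |        | m
  v        v
  K' ----> X
      d
```
The square is a pullback, and for every `z : Z ⟶ X` and every pullback `(x, y)` of `(m, z)` such
that `x` factors through `c`, there is a unique `w` with `z = w ≫ d`. -/
structure IsFPC {K I K' X : C} (c : K ⟶ I) (m : I ⟶ X) (b : K ⟶ K') (d : K' ⟶ X) : Prop where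
  isPullback : IsPullback c b m d
  final : ∀ {P Z : C} (x : P ⟶ I) (y : P ⟶ Z) (z : Z ⟶ X), IsPullback x y m z →
    (∃ w : P ⟶ K, w ≫ c = x) → ∃! w : Z ⟶ K', w ≫ d = z

/-- The two rewriting semantics: Double-Pushout and Sesqui-Pushout. -/
inductive Semantics
  | DPO
  | SqPO

/-- `K -b→ K' -d→ X` is a complement of `K -c→ I -m→ X` of the given type: a pushout complement
for `DPO`, a final pullback complement for `SqPO`. -/
def IsComplement (T : Semantics) {K I K' X : C} (c : K ⟶ I) (m : I ⟶ X) (b : K ⟶ K')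
    (d : K' ⟶ X) : Prop :=
  match T with
  | .DPO => IsPushout c b m d
  | .SqPO => IsFPC c m b d

/-- A `T`-type direct derivation (rule application) of `r = (O ← K → I)` to `X` along the match
`m : I ⟶ X`:
```
  O <----- K -----> I
  |        |        |
 mStar     k        m
  v        v        v
  Y <----- K' ----> X
    dStar      d
```
The right square is a `T`-complement, the left square is a pushout. -/
structure DirectDerivation (T : Semantics) {O I : C} (r : Rule O I) {X : C} (m : I ⟶ X) where
  mono_m : Mono m
  K' : C
  k : r.K ⟶ K'
  d : K' ⟶ X
  complement : IsComplement T r.i m k d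
  Y : C
  mStar : O ⟶ Y
  dStar : K' ⟶ Y
  pushout : IsPushout r.o k mStar dStar

/-- A derivation of type `DPO†` of `r = (O ← K → I)` along `n : O ⟶ Y`: the left square
(over `O`) is a pushout complement, the right square (over `I`) is a pushout.
```
  O <----- K -----> I
  |        |        |
  n        k      nStar
  v        v        v
  Y <----- K' ----> X
      e       eStar
```
-/
structure DaggerDerivation {O I : C} (r : Rule O I) {Y : C} (n : O ⟶ Y) where
  mono_n : Mono n
  K' : C
  k : r.K ⟶ K'
  e : K' ⟶ Y
  complement : IsPushout r.o k n e
  X : C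
  nStar : I ⟶ X
  eStar : K' ⟶ X
  pushout : IsPushout r.i k nStar eStar

theorem mono_of_isComplement [Adhesive C] {T : Semantics} {K I K' X : C} {c : K ⟶ I} {m : I ⟶ X}
    {b : K ⟶ K'} {d : K' ⟶ X} [Mono c] [Mono m] (h : IsComplement T c m b d) : Mono d := by
  cases T with
  | DPO => exact Adhesive.mono_of_isPushout_of_mono_left (show IsPushout c b m d from h)
  | SqPO =>
    have h' : IsFPC c m b d := h
    refine ⟨fun {Z} f g hfg => ?_⟩
    have hex := h'.final (pullback.fst m (f ≫ d)) (pullback.snd m (f ≫ d)) (f ≫ d)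
      (IsPullback.of_hasPullback m (f ≫ d))
      ⟨h'.isPullback.lift (pullback.fst m (f ≫ d)) (pullback.snd m (f ≫ d) ≫ f)
        (by rw [pullback.condition, Category.assoc]), h'.isPullback.lift_fst _ _ _⟩
    exact hex.unique rfl hfg.symm

/-- The span `Y ← K' → X` in the bottom row of a direct derivation. -/
def DirectDerivation.bottom [Adhesive C] {T : Semantics} {O I : C} {r : Rule O I} {X : C} {m : I ⟶ X}
    (D : DirectDerivation T r m) : Rule D.Y X where
  K := D.K'
  o := D.dStar
  i := D.d
  mono_o := Adhesive.mono_of_isPushout_of_mono_left D.pushout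
  mono_i := have := D.mono_m; mono_of_isComplement D.complement

/-- The span `Y ← K' → X` in the bottom row of a `DPO†`-type derivation. -/
def DaggerDerivation.bottom [Adhesive C] {O I : C} {r : Rule O I} {Y : C} {n : O ⟶ Y}
    (D : DaggerDerivation r n) : Rule Y D.X where
  K := D.K'
  o := D.e
  i := D.eStar
  mono_o := Adhesive.mono_of_isPushout_of_mono_left D.complement
  mono_i := Adhesive.mono_of_isPushout_of_mono_left D.pushout

theorem DaggerDerivation.mono_nStar [Adhesive C] {O I : C} {r : Rule O I} {Y : C} {n : O ⟶ Y}
    (D : DaggerDerivation r n) : Mono D.nStar := by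
  have := D.mono_n
  have : Mono (D.k ≫ D.e) := by rw [← D.complement.w]; infer_instance
  have : Mono D.k := mono_of_mono D.k D.e
  exact Adhesive.mono_of_isPushout_of_mono_right D.pushout

/-! ### Conditions -/

/-- Conditions over an object. -/
inductive Condition : C → Type (max u v + 1)
  | true {X : C} : Condition X
  | ex {X A : C} (a : X ⟶ A) (mono_a : Mono a) (c : Condition A) : Condition X
  | neg {X : C} (c : Condition X) : Condition X
  | conj {X : C} {ι : Type (max u v)} (c : ι → Condition X) : Condition X

namespace Condition

/-- Satisfaction `m ⊨ c` of a condition `c` over `X` by `m : X ⟶ Y`. -/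
def Sat : {X : C} → Condition X → {Y : C} → (X ⟶ Y) → Prop
  | _, .true, _, _ => True
  | _, .ex (A := A) a _ c, Y, m => ∃ q : A ⟶ Y, Mono q ∧ a ≫ q = m ∧ Sat c q
  | _, .neg c, _, m => ¬ Sat c m
  | _, .conj c, _, m => ∀ i, Sat (c i) m

/-- Disjunction of a family of conditions. -/
def disj {X : C} {ι : Type (max u v)} (c : ι → Condition X) : Condition X :=
  .neg (.conj fun i => .neg (c i))

/-- Conjunction of two conditions. -/
def and {X : C} (c c' : Condition X) : Condition X :=
  .conj fun b : ULift.{max u v} Bool => if b.down then c else c'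

end Condition

/-- The index set of the disjunction in `Shift(a₁, ∃(a₂, c))`: spans of monomorphisms
`B₁ ←b₁- D -b₂→ B₂` under `A`, with a pushout `B₁ -e₁→ E ←e₂- B₂`. Every representative of an
isomorphism class is listed; this does not change the disjunction up to equivalence. -/
structure ShiftIndex {A B₁ B₂ : C} (a₁ : A ⟶ B₁) (a₂ : A ⟶ B₂) where
  D : C
  δ : A ⟶ D
  b₁ : D ⟶ B₁
  b₂ : D ⟶ B₂
  mono_b₁ : Mono b₁
  mono_b₂ : Mono b₂
  δ_b₁ : δ ≫ b₁ = a₁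
  δ_b₂ : δ ≫ b₂ = a₂
  E : C
  e₁ : B₁ ⟶ E
  e₂ : B₂ ⟶ E
  pushout : IsPushout b₁ b₂ e₁ e₂

theorem ShiftIndex.mono_e₁ [Adhesive C] {A B₁ B₂ : C} {a₁ : A ⟶ B₁} {a₂ : A ⟶ B₂}
    (s : ShiftIndex a₁ a₂) : Mono s.e₁ :=
  have := s.mono_b₂
  Adhesive.mono_of_isPushout_of_mono_right s.pushout

namespace Condition

variable [Adhesive C]

/-- `Shift(a₁, c)` of a condition `c` over `A` along `a₁ : A ⟶ B₁`, a condition over `B₁`. -/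
def shift : {A : C} → Condition A → {B₁ : C} → (A ⟶ B₁) → Condition B₁
  | _, .true, _, _ => .true
  | _, .ex a₂ _ c, _, a₁ =>
      disj fun s : ShiftIndex a₁ a₂ => .ex s.e₁ s.mono_e₁ (shift c s.e₂)
  | _, .neg c, _, a₁ => .neg (shift c a₁)
  | _, .conj c, _, a₁ => .conj fun i => shift (c i) a₁

/-- `Trans(r, c)` of a condition `c` over the output `O` of `r = (O ← K → I)`, a condition
over `I`. For `c = ∃(b : O → B, c')` the disjunction runs over all `DPO†`-type derivations of `r`
along `b`. Since these are unique up to isomorphism if they exist, it has up to equivalence one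
disjunct if `b` is a `DPO†`-admissible match, and it is the empty disjunction `false` otherwise. -/
def trans : {O : C} → Condition O → {I : C} → Rule O I → Condition I
  | _, .true, _, _ => .true
  | _, .ex b _ c, _, r =>
      disj fun D : DaggerDerivation r b => .ex D.nStar D.mono_nStar (trans c D.bottom)
  | _, .neg c, _, r => .neg (trans c r)
  | _, .conj c, _, r => .conj fun i => trans (c i) r

end Condition

/-! ### Sequential independence -/

/-- Sequential independence of two consecutive rule applications
`X₀ ⇒ X₁ ⇒ X₂`, where `D₁` applies `r₁` to `X₀` and `D₂` applies `r₂` to `X₁ = D₁.Y`. -/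
def SeqIndependent {T : Semantics} {O₁ I₁ O₂ I₂ : C} {r₁ : Rule O₁ I₁} {r₂ : Rule O₂ I₂}
    {X₀ : C} {m₁ : I₁ ⟶ X₀} (D₁ : DirectDerivation T r₁ m₁) {m₂ : I₂ ⟶ D₁.Y}
    (D₂ : DirectDerivation T r₂ m₂) : Prop :=
  ∃ (n₁ : O₁ ⟶ D₂.K') (n₂ : I₂ ⟶ D₁.K'), Mono n₁ ∧ Mono n₂ ∧
    n₁ ≫ D₂.d = D₁.mStar ∧ n₂ ≫ D₁.dStar = m₂

/-- The two-step derivation `F₂`, `F₁` applies `r₂` and then `r₁`, starting from the same object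
as the two-step derivation `D₁`, `D₂`, which applies `r₁` and then `r₂`, and along the same
instances: the match of `F₂` is the match of `D₂` pulled back through `D₁`, and the match of `F₁`
is the match of `D₁` pushed forward through `F₂`. -/
def IsSwitch {T : Semantics} {O₁ I₁ O₂ I₂ : C} {r₁ : Rule O₁ I₁} {r₂ : Rule O₂ I₂}
    {X₀ : C} {m₁ : I₁ ⟶ X₀} (D₁ : DirectDerivation T r₁ m₁) {m₂ : I₂ ⟶ D₁.Y}
    (_D₂ : DirectDerivation T r₂ m₂) {m₂' : I₂ ⟶ X₀} (F₂ : DirectDerivation T r₂ m₂') {m₁' : I₁ ⟶ F₂.Y}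
    (_F₁ : DirectDerivation T r₁ m₁') : Prop :=
  (∃ n₂ : I₂ ⟶ D₁.K', n₂ ≫ D₁.dStar = m₂ ∧ n₂ ≫ D₁.d = m₂') ∧
    (∃ n₁ : I₁ ⟶ F₂.K', n₁ ≫ F₂.d = m₁ ∧ n₁ ≫ F₂.dStar = m₁')

/-- Compatibility of the conditions `c₁`, `c₂` of two rules with switching, for all
sequential applications that glue `r₂` to `r₁` along `I₂ ←μ₂- M -μ₁→ O₁`: whenever `r₁` is applied
and then `r₂` with this overlap, and the applications can be switched, the matches of the original
sequence satisfy the conditions of the two rules iff the matches of the switched one do. -/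
def ConditionsSwitch (T : Semantics) {O₁ I₁ O₂ I₂ : C} (r₁ : Rule O₁ I₁) (c₁ : Condition I₁)
    (r₂ : Rule O₂ I₂) (c₂ : Condition I₂) {M : C} (μ₂ : M ⟶ I₂) (μ₁ : M ⟶ O₁) : Prop :=
  ∀ (Y : C) (m₁ : I₁ ⟶ Y) (D₁ : DirectDerivation T r₁ m₁) (m₂ : I₂ ⟶ D₁.Y) (D₂ : DirectDerivation T r₂ m₂),
    IsPullback μ₂ μ₁ m₂ D₁.mStar →
    ∀ (m₂' : I₂ ⟶ Y) (F₂ : DirectDerivation T r₂ m₂') (m₁' : I₁ ⟶ F₂.Y) (F₁ : DirectDerivation T r₁ m₁'),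
      IsSwitch D₁ D₂ F₂ F₁ → ((c₁.Sat m₁ ∧ c₂.Sat m₂) ↔ (c₂.Sat m₂' ∧ c₁.Sat m₁'))

/-! ### Rule composition -/

/-- The diagram of the `T`-type composition of `r₂` with `r₁` along the match
`I₂ ←μ₂- M -μ₁→ O₁` (in particular the span is a `T`-admissible match of `r₂` into `r₁`):
`N` is the pushout of the span; `left` is the `T`-type derivation of `r₂` along `I₂ → N`, with
`K̄₂ = left.K'` and `O₂₁ = left.Y`; `right` is the `DPO†`-type derivation of `r₁` along `O₁ → N`,
with `K̄₁ = right.K'` and `I₂₁ = right.X`. -/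
structure CompositeDiagram (T : Semantics) {O₁ I₁ O₂ I₂ : C} (r₂ : Rule O₂ I₂) (r₁ : Rule O₁ I₁)
    {M : C} (μ₂ : M ⟶ I₂) (μ₁ : M ⟶ O₁) where
  N : C
  n₂ : I₂ ⟶ N
  n₁ : O₁ ⟶ N
  pushout : IsPushout μ₂ μ₁ n₂ n₁
  left : DirectDerivation T r₂ n₂
  right : DaggerDerivation r₁ n₁

namespace CompositeDiagram

variable {T : Semantics} {O₁ I₁ O₂ I₂ : C} {r₁ : Rule O₁ I₁} {r₂ : Rule O₂ I₂} {M : C}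
  {μ₂ : M ⟶ I₂} {μ₁ : M ⟶ O₁}

/-- Monomorphisms `O₁ → K̄₂` and `I₂ → K̄₁` through which `O₁ → N` and `I₂ → N` factor. -/
structure Factorization (Δ : CompositeDiagram T r₂ r₁ μ₂ μ₁) where
  j₁ : O₁ ⟶ Δ.left.K'
  j₂ : I₂ ⟶ Δ.right.K'
  mono_j₁ : Mono j₁
  mono_j₂ : Mono j₂
  fac₁ : j₁ ≫ Δ.left.d = Δ.n₁
  fac₂ : j₂ ≫ Δ.right.e = Δ.n₂

/-- The composite of the two rules in the opposite order. The match of `r₁` into `r₂` is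
`I₁ ← K₁ ← M → K₂ → O₂`, where `a₁ : M → K₁` and `a₂ : M → K₂` are the (unique) lifts of the
given match. The input `I₁₂` of the opposite composite is identified with `I₂₁` by the (unique)
isomorphism compatible with the inclusions of `I₁` and `I₂`. -/
structure Opposite (Δ : CompositeDiagram T r₂ r₁ μ₂ μ₁) (f : Δ.Factorization) where
  a₁ : M ⟶ r₁.K
  a₂ : M ⟶ r₂.K
  a₁_o : a₁ ≫ r₁.o = μ₁
  a₂_i : a₂ ≫ r₂.i = μ₂
  Δ' : CompositeDiagram T r₁ r₂ (a₁ ≫ r₁.i) (a₂ ≫ r₂.o)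
  j : I₁ ⟶ Δ'.right.K'
  fac : j ≫ Δ'.right.e = Δ'.n₂
  φ : Δ'.right.X ≅ Δ.right.X
  φ_I₁ : (j ≫ Δ'.right.eStar) ≫ φ.hom = Δ.right.nStar
  φ_I₂ : Δ'.right.nStar ≫ φ.hom = f.j₂ ≫ Δ.right.eStar

variable [Adhesive C]

/-- The condition
`c_{I₂₁} = Shift(I₁ → I₂₁, c₁) ∧ Trans(N ⇐ I₂₁, Shift(I₂ → N, c₂))` of the composite rule. -/
def condition (Δ : CompositeDiagram T r₂ r₁ μ₂ μ₁) (c₂ : Condition I₂) (c₁ : Condition I₁) :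
    Condition Δ.right.X :=
  (c₁.shift Δ.right.nStar).and ((c₂.shift Δ.n₂).trans Δ.right.bottom)

/-- `m : I₂₁ ⟶ Y` is a `T`-admissible match of the composite `(O₂₁ ⇐ N) ∘ (N ⇐ I₂₁)`: the
composite can be applied along `m`, i.e. there are `T`-type derivations along `N ⇐ I₂₁` with
match `m`, and then along `O₂₁ ⇐ N` with match the comatch of the first. -/
def Admissible (Δ : CompositeDiagram T r₂ r₁ μ₂ μ₁) {Y : C} (m : Δ.right.X ⟶ Y) : Prop :=
  ∃ E : DirectDerivation T Δ.right.bottom m, Nonempty (DirectDerivation T Δ.left.bottom E.mStar)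

/-- `c_{I₂₁}` and `c_{I₁₂}` are equivalent up to `T`-type admissibility: they are satisfied by
the same `T`-admissible matches of the composite rules. -/
def ConditionsEquivalent (Δ : CompositeDiagram T r₂ r₁ μ₂ μ₁) {f : Δ.Factorization}
    (S : Δ.Opposite f) (c₂ : Condition I₂) (c₁ : Condition I₁) : Prop :=
  ∀ (Y : C) (m : Δ.right.X ⟶ Y), Δ.Admissible m → S.Δ'.Admissible (S.φ.hom ≫ m) →
    ((Δ.condition c₂ c₁).Sat m ↔ (S.Δ'.condition c₁ c₂).Sat (S.φ.hom ≫ m))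

end CompositeDiagram

end Rewriting

open Rewriting

/-!
The argument treats monos as inclusions of subobjects and uses two facts about adhesive categories:
the pushout of two subobjects over their intersection is their union
(`mono_of_isPushout_of_isPullback`), and a pushout complement of monos is a final pullback
complement (`isFPC_of_isPushout`). By the second fact, complements of both types, as well as the
pushout squares of `DPO†`-type derivations, have the universal property of final pullback
complements. Complements of either type paste, restrict to subobjects `N` of `X` with
`I ⊆ N ⊆ X` (`IsComplement.restrict`), and cancel: the complement of `I` in `X` is the complement
of `N` in `X` relative to the complement of `I` in `N` (`IsComplement.exists_cancel`).

*Independence.* The intermediate object `X₁` contains `N` as the union of `I₂` and `O₁`, so the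
composite diagram is the restriction of the two applications to `N`. By finality, a map from `O₁`
to the complement of `r₂`, in `X₁` or in `N`, is the same as a lift of `M → I₂` to `K₂`, and
dually for `I₂` (`IsFPC.exists_factor_iff`). Sequential independence and the existence of a
factorization therefore both say that `M` lifts to `K₁` and `K₂`.

*The opposite composite.* If `M` lifts to `K₁` and `K₂`, the input `I₂₁` is the union of `I₁` and
`I₂` along `M` (`Factorization.isPushout`), a description which is symmetric in the two rules. In
the union `N₁₂` of `I₁` and `O₂` the complement of `O₂` is the union of `I₁` and `K₂`, and that of
`I₁` is the union of `K₁` and `O₂`.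

*Conditions.* Satisfaction of a shifted condition at `m` is satisfaction of the original condition
at the composite (`Condition.sat_shift`), and satisfaction of a transported condition at a match is
satisfaction of the original one at the comatch (`Condition.sat_trans`). Hence the composite
condition at an admissible `m : I₂₁ → Y` is the conjunction of the conditions of the rules at the
matches of the two-step application into which `m` decomposes. Pasting turns an `m` admissible for
both composites into a pair of two-step applications which are switches of each other, and
conversely such a pair glues the images of `I₁` and `I₂` in `Y` to an `m` admissible for both
composites (`conditionsSwitch_iff`).
-/

namespace Rewriting

variable {C : Type u} [Category.{v} C]

/-! ### Squares of monomorphisms -/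

theorem isPullback_comp_mono_iff {P X Y Z Z' : C} {fst : P ⟶ X} {snd : P ⟶ Y} {f : X ⟶ Z}
    {g : Y ⟶ Z} (q : Z ⟶ Z') [Mono q] :
    IsPullback fst snd (f ≫ q) (g ≫ q) ↔ IsPullback fst snd f g := by
  constructor
  · intro h
    exact .mk' ((cancel_mono q).1 (by simpa using h.w)) (fun _ _ _ h₁ h₂ => h.hom_ext h₁ h₂)
      fun _ a b hab => h.exists_lift a b (by simp only [reassoc_of% hab])
  · intro h
    exact .mk' (by simp only [reassoc_of% h.w]) (fun _ _ _ h₁ h₂ => h.hom_ext h₁ h₂)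
      fun _ a b hab => h.exists_lift a b ((cancel_mono q).1 (by simpa using hab))

/-- Unions of subobjects are effective: the pushout of `X` and `Y` over their intersection in `S`
is a subobject of `S`. -/
theorem mono_of_isPushout_of_isPullback [Adhesive C] {W X Y Z S : C} {f : W ⟶ X} {g : W ⟶ Y}
    {h : X ⟶ Z} {i : Y ⟶ Z} {a : X ⟶ S} {b : Y ⟶ S} {t : Z ⟶ S} [Mono a] [Mono b]
    (hpo : IsPushout f g h i) (hpb : IsPullback f g a b) (ha : h ≫ t = a) (hb : i ≫ t = b) :
    Mono t := by
  have hpo' : IsPushout f g (pushout.inl (pullback.fst a b) (pullback.snd a b))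
      (pushout.inr (pullback.fst a b) (pullback.snd a b)) :=
    (IsPushout.of_hasPushout _ _).of_iso hpb.isoPullback.symm (Iso.refl _) (Iso.refl _)
      (Iso.refl _) (by simp) (by simp) (by simp) (by simp)
  have ht : t = (hpo.isoIsPushout _ _ hpo').hom ≫ pushout.desc a b pullback.condition := by
    apply hpo.hom_ext
    · simpa [ha] using (pushout.inl_desc a b pullback.condition).symm
    · simpa [hb] using (pushout.inr_desc a b pullback.condition).symm
  rw [ht]
  infer_instance

/-- A pushout along a mono restricts to any subobject `γ` of its vertex that contains one of the
two legs. -/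
theorem isPushout_restrict [Adhesive C] {W X Y Z Y' Z' : C} {f : W ⟶ X} {g : W ⟶ Y} {h : X ⟶ Z}
    {i : Y ⟶ Z} [Mono f] (H : IsPushout f g h i) {g' : W ⟶ Y'} {h' : X ⟶ Z'} {i' : Y' ⟶ Z'}
    {β : Y' ⟶ Y} {γ : Z' ⟶ Z} [Mono γ] (hg : g' ≫ β = g) (hh : h' ≫ γ = h)
    (hp : IsPullback i' β γ i) : IsPushout f g' h' i' := by
  have hβ : Mono β := hp.mono_snd_of_mono
  have w : f ≫ h' = g' ≫ i' := by
    rw [← cancel_mono γ, Category.assoc, Category.assoc, hh, hp.w, reassoc_of% hg, H.w]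
  refine (Adhesive.van_kampen H f g' h' i' (𝟙 W) (𝟙 X) β γ (.id_vert f) ?_ ⟨by simp [hh]⟩
    hp.toCommSq ⟨w⟩).2 ⟨?_, hp⟩
  · exact .of_vert_isIso_mono ⟨by simp [hg]⟩
  · exact .of_vert_isIso_mono ⟨by simp [hh]⟩

/-! ### Complements -/

/-- Pushout complements along monos are final pullback complements. If `z : Z ⟶ X` meets `I` only
in `K`, then pulling the pushout back along `z` presents `Z` as a pushout along an isomorphism, so
that `Z` coincides with its intersection with `K'`. -/
theorem isFPC_of_isPushout [Adhesive C] [HasPullbacks C] {K I K' X : C} {c : K ⟶ I} {m : I ⟶ X}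
    {b : K ⟶ K'} {d : K' ⟶ X} [Mono c] (h : IsPushout c b m d) : IsFPC c m b d where
  isPullback := Adhesive.isPullback_of_isPushout_of_mono_left h
  final := by
    rintro P Z x y z hz ⟨w, hw⟩
    have hd : Mono d := Adhesive.mono_of_isPushout_of_mono_left h
    obtain ⟨W, f', g', αW, hf, -, hpo⟩ := (Adhesive.van_kampen h).exists_cube_filling hz.flip
      (IsPullback.of_hasPullback z d)
    have hf' : Mono f' := hf.mono_fst_of_mono
    have : IsSplitEpi f' := ⟨⟨hf.lift (𝟙 P) w (by simp [hw]), hf.lift_fst _ _ _⟩⟩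
    have : IsIso f' := isIso_of_mono_of_isSplitEpi f'
    have : IsIso (pullback.fst z d) := hpo.isIso_inr_of_isIso
    refine ⟨inv (pullback.fst z d) ≫ pullback.snd z d, ?_, fun w' hw' => ?_⟩
    · simp [← pullback.condition]
    · rw [← cancel_mono d, hw']
      simp [← pullback.condition]

namespace IsFPC

variable {K I K' X : C} {c : K ⟶ I} {m : I ⟶ X} {k : K ⟶ K'} {d : K' ⟶ X}

theorem paste [HasPullbacks C] {K₂ X₂ : C} {n : X ⟶ X₂} {u : K' ⟶ K₂} {d' : K₂ ⟶ X₂}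
    (h : IsFPC c m k d) (h' : IsFPC d n u d') : IsFPC c (m ≫ n) (k ≫ u) d' where
  isPullback := h.isPullback.paste_vert h'.isPullback
  final := by
    rintro P Z x y z hz ⟨w, hw⟩
    have hpb := IsPullback.of_hasPullback n z
    obtain ⟨l, hl₁, hl₂⟩ := hpb.exists_lift (x ≫ m) y (by simpa using hz.w)
    have hz' : IsPullback x l m (pullback.fst n z) := by
      refine .of_bot (v₂₁ := pullback.snd n z) ?_ hl₁.symm hpb
      rwa [hl₂]
    obtain ⟨w', hw', -⟩ := h.final x l _ hz' ⟨w, hw⟩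
    exact h'.final _ _ z hpb ⟨w', hw'⟩

/-- A map into `N ⊆ X` whose pullback along `I` is `K` factors through the complement of `I` in `X`. -/
theorem exists_map {K₀ N : C} {n : I ⟶ N} {d₀ : K₀ ⟶ N} {k₀ : K ⟶ K₀} {q : N ⟶ X}
    [Mono q] (h : IsFPC c (n ≫ q) k d) (h₀ : IsPullback c k₀ n d₀) :
    ∃ u : K₀ ⟶ K', u ≫ d = d₀ ≫ q :=
  (h.final c k₀ (d₀ ≫ q) ((isPullback_comp_mono_iff q).2 h₀) ⟨𝟙 K, by simp⟩).exists

/-- For `I ⊆ N ⊆ X`, the part of `Z` inside `N` lies in `K₀` if and only if the part inside `I`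
lies in `K`. -/
theorem cancel [HasPullbacks C] {K₀ N : C} {n : I ⟶ N} {d₀ : K₀ ⟶ N} {k₀ : K ⟶ K₀} {q : N ⟶ X}
    {u : K₀ ⟶ K'} [Mono d] [Mono d₀] (h : IsFPC c (n ≫ q) k d) (h₀ : IsFPC c n k₀ d₀)
    (hu : u ≫ d = d₀ ≫ q) : IsFPC d₀ q u d where
  isPullback := by
    refine .mk' hu.symm (fun _ _ _ h₁ _ => (cancel_mono d₀).1 h₁) fun _ a b hab => ?_
    have hpb := IsPullback.of_hasPullback n a
    obtain ⟨w, hw, -⟩ := h.isPullback.exists_lift (pullback.fst n a) (pullback.snd n a ≫ b)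
      (by rw [Category.assoc, ← hab, reassoc_of% hpb.w])
    obtain ⟨l, hl, -⟩ := h₀.final _ _ a hpb ⟨w, hw⟩
    exact ⟨l, hl, by rw [← cancel_mono d, Category.assoc, hu, reassoc_of% hl, hab]⟩
  final := by
    rintro P Z x y z hz ⟨w, hw⟩
    have hpb := IsPullback.of_hasPullback (n ≫ q) z
    obtain ⟨l, hl, -⟩ := hz.exists_lift (pullback.fst (n ≫ q) z ≫ n) (pullback.snd (n ≫ q) z)
      (by simpa using hpb.w)
    obtain ⟨w', hw', -⟩ := h₀.isPullback.exists_lift (pullback.fst (n ≫ q) z) (l ≫ w)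
      (by rw [Category.assoc, hw, hl])
    exact h.final _ _ z hpb ⟨w', hw'⟩

theorem restrict {K₀ N : C} {n : I ⟶ N} {d₀ : K₀ ⟶ N} {k₀ : K ⟶ K₀} {q : N ⟶ X}
    {u : K₀ ⟶ K'} [Mono q] (h : IsFPC c (n ≫ q) k d) (hp : IsPullback d₀ u q d)
    (hk : k₀ ≫ u = k) : IsFPC c n k₀ d₀ where
  isPullback := by
    have hu : Mono u := hp.mono_snd_of_mono
    refine .mk' ?_ (fun _ _ _ h₁ h₂ => h.isPullback.hom_ext h₁ ?_) fun _ a b hab => ?_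
    · rw [← cancel_mono q, Category.assoc, Category.assoc, hp.w, reassoc_of% hk, h.isPullback.w]
    · rw [← hk, reassoc_of% h₂]
    · obtain ⟨l, hl₁, hl₂⟩ := h.isPullback.exists_lift a (b ≫ u)
        (by rw [Category.assoc, ← hp.w, reassoc_of% hab])
      exact ⟨l, hl₁, by rw [← cancel_mono u, Category.assoc, hk, hl₂]⟩
  final := by
    rintro P Z x y z hz hw
    obtain ⟨w, hw, huniq⟩ := h.final x y (z ≫ q) ((isPullback_comp_mono_iff q).2 hz) hw
    refine ⟨hp.lift z w hw.symm, hp.lift_fst _ _ _, fun w' hw' => hp.hom_ext ?_ ?_⟩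
    · simp [hw']
    · rw [hp.lift_snd]
      exact huniq _ (by simp only [Category.assoc, ← hp.w, reassoc_of% hw'])

end IsFPC

section IsComplement

variable {T : Semantics} {K I K' X : C} {c : K ⟶ I} {m : I ⟶ X} {k : K ⟶ K'} {d : K' ⟶ X}

theorem IsComplement.paste [HasPullbacks C] {K₂ X₂ : C} {n : X ⟶ X₂} {u : K' ⟶ K₂} {d' : K₂ ⟶ X₂}
    (h : IsComplement T c m k d) (h' : IsComplement T d n u d') :
    IsComplement T c (m ≫ n) (k ≫ u) d' := by
  cases T with
  | DPO => exact IsPushout.paste_vert (show IsPushout c k m d from h) h'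
  | SqPO => exact IsFPC.paste (show IsFPC c m k d from h) h'

theorem IsComplement.restrict [Adhesive C] {K₀ N : C} {n : I ⟶ N} {d₀ : K₀ ⟶ N} {k₀ : K ⟶ K₀}
    {q : N ⟶ X} {u : K₀ ⟶ K'} [Mono c] [Mono q] (h : IsComplement T c (n ≫ q) k d)
    (hp : IsPullback d₀ u q d) (hk : k₀ ≫ u = k) : IsComplement T c n k₀ d₀ := by
  cases T with
  | DPO => exact isPushout_restrict h hk rfl hp
  | SqPO => exact IsFPC.restrict h hp hk

variable [Adhesive C] [HasPullbacks C]

theorem IsComplement.isFPC [Mono c] (h : IsComplement T c m k d) : IsFPC c m k d := by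
  cases T with
  | DPO => exact isFPC_of_isPushout h
  | SqPO => exact h

theorem isComplement_of_isPushout [Mono c] (h : IsPushout c k m d) : IsComplement T c m k d := by
  cases T with
  | DPO => exact h
  | SqPO => exact isFPC_of_isPushout h

/-- If `I ⊆ N ⊆ X`, then the complement `K'` of `I` in `X` is also the complement in `X` of `N`,
relative to the complement `K₀` of `I` in `N`. -/
theorem IsComplement.exists_cancel {K₀ N : C} {n : I ⟶ N} {d₀ : K₀ ⟶ N} {k₀ : K ⟶ K₀} {q : N ⟶ X}
    [Mono c] [Mono n] [Mono q] (h : IsComplement T c (n ≫ q) k d) (h₀ : IsComplement T c n k₀ d₀) :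
    ∃ u : K₀ ⟶ K', k₀ ≫ u = k ∧ u ≫ d = d₀ ≫ q ∧ IsComplement T d₀ q u d := by
  have hd : Mono d := mono_of_isComplement h
  have hd₀ : Mono d₀ := mono_of_isComplement h₀
  obtain ⟨u, hu⟩ := h.isFPC.exists_map h₀.isFPC.isPullback
  have hk : k₀ ≫ u = k := by
    rw [← cancel_mono d, Category.assoc, hu, ← reassoc_of% h₀.isFPC.isPullback.w,
      h.isFPC.isPullback.w]
  refine ⟨u, hk, hu, ?_⟩
  subst hk
  cases T with
  | DPO => exact IsPushout.of_top h hu.symm h₀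
  | SqPO => exact IsFPC.cancel h h₀ hu

/-- A subobject `N` of `X` containing `I` has a complement if `X` has one. -/
theorem IsComplement.exists_restrict {N : C} {n : I ⟶ N} {q : N ⟶ X} [Mono c] [Mono q]
    (h : IsComplement T c (n ≫ q) k d) :
    ∃ (K₀ : C) (k₀ : K ⟶ K₀) (d₀ : K₀ ⟶ N) (u : K₀ ⟶ K'),
      k₀ ≫ u = k ∧ IsPullback d₀ u q d ∧ IsComplement T c n k₀ d₀ := by
  have hp := IsPullback.of_hasPullback q d
  have w : (c ≫ n) ≫ q = k ≫ d := by simpa using h.isFPC.isPullback.w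
  exact ⟨_, hp.lift (c ≫ n) k w, _, _, hp.lift_snd _ _ _, hp, h.restrict hp (hp.lift_snd _ _ _)⟩

end IsComplement

/-! ### Rule applications -/

theorem mono_of_isComplement_right [Adhesive C] [HasPullbacks C] {T : Semantics} {K I K' X : C}
    {c : K ⟶ I} {m : I ⟶ X} {k : K ⟶ K'} {d : K' ⟶ X} [Mono c] [Mono m]
    (h : IsComplement T c m k d) : Mono k :=
  h.isFPC.isPullback.mono_snd_of_mono

theorem DirectDerivation.mono_k [Adhesive C] [HasPullbacks C] {T : Semantics} {O I X : C}
    {r : Rule O I} {m : I ⟶ X} (D : DirectDerivation T r m) : Mono D.k :=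
  have := D.mono_m
  mono_of_isComplement_right D.complement

theorem DirectDerivation.mono_d [Adhesive C] {T : Semantics} {O I X : C}
    {r : Rule O I} {m : I ⟶ X} (D : DirectDerivation T r m) : Mono D.d :=
  D.bottom.mono_i

theorem DirectDerivation.mono_mStar [Adhesive C] [HasPullbacks C] {T : Semantics} {O I X : C}
    {r : Rule O I} {m : I ⟶ X} (D : DirectDerivation T r m) : Mono D.mStar :=
  have := D.mono_k
  Adhesive.mono_of_isPushout_of_mono_right D.pushout

theorem nonempty_directDerivation [Adhesive C] [HasPullbacks C] {T : Semantics} {O I K' X : C}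
    (r : Rule O I) {m : I ⟶ X} [Mono m] {k : r.K ⟶ K'} {d : K' ⟶ X}
    (h : IsComplement T r.i m k d) : Nonempty (DirectDerivation T r m) :=
  ⟨⟨inferInstance, K', k, d, h, _, _, _, IsPushout.of_hasPushout r.o k⟩⟩

theorem nonempty_daggerDerivation [Adhesive C] {O I K' X : C}
    (r : Rule O I) {n : O ⟶ X} [Mono n] {k : r.K ⟶ K'} {e : K' ⟶ X}
    (h : IsPushout r.o k n e) : Nonempty (DaggerDerivation r n) :=
  ⟨⟨inferInstance, K', k, e, h, _, _, _, IsPushout.of_hasPushout r.i k⟩⟩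

/-- If the match of an application of `r` extends to a mono `q` on the input `D.X` of the bottom
rule of a `DPO†`-type derivation `D` of `r`, then this bottom rule applies along `q`, with the
same complement and the same result. -/
theorem DaggerDerivation.exists_extension [Adhesive C] [HasPullbacks C] {T : Semantics}
    {O I B X Y K' : C} {r : Rule O I} {b : O ⟶ B} (D : DaggerDerivation r b) {q : D.X ⟶ X} [Mono q]
    {k : r.K ⟶ K'} {d : K' ⟶ X} {s : O ⟶ Y} {t : K' ⟶ Y}
    (hc : IsComplement T r.i (D.nStar ≫ q) k d) (hp : IsPushout r.o k s t) :
    ∃ (u : D.K' ⟶ K') (p : B ⟶ Y), Mono p ∧ u ≫ d = D.eStar ≫ q ∧ b ≫ p = s ∧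
      IsComplement T D.eStar q u d ∧ IsPushout D.e u p t := by
  have := D.mono_nStar
  obtain ⟨u, rfl, hu, hcu⟩ := hc.exists_cancel (isComplement_of_isPushout D.pushout)
  have hst : r.o ≫ s = D.k ≫ u ≫ t := by simpa using hp.w
  have hp' : IsPushout D.e u (D.complement.desc s (u ≫ t) hst) t := by
    refine .of_top ?_ (D.complement.inr_desc _ _ _) D.complement
    rwa [D.complement.inl_desc]
  have : Mono D.eStar := D.bottom.mono_i
  have : Mono u := mono_of_isComplement_right hcu
  exact ⟨u, _, Adhesive.mono_of_isPushout_of_mono_right hp', hu, D.complement.inl_desc _ _ _, hcu,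
    hp'⟩

/-- Every extension `p : B ⟶ Y` of the comatch of an application of `r` arises from a
`DPO†`-type derivation of `r` whose result is a subobject `q` of the original object. -/
theorem exists_daggerDerivation [Adhesive C] [HasPullbacks C] {T : Semantics}
    {O I B X Y K' : C} (r : Rule O I) {m : I ⟶ X} [Mono m]
    {k : r.K ⟶ K'} {d : K' ⟶ X} {s : O ⟶ Y} {t : K' ⟶ Y}
    (hc : IsComplement T r.i m k d) (hp : IsPushout r.o k s t) (b : O ⟶ B) (p : B ⟶ Y) [Mono p]
    (hbp : b ≫ p = s) :
    ∃ (D : DaggerDerivation r b) (q : D.X ⟶ X) (u : D.K' ⟶ K'), Mono q ∧ D.nStar ≫ q = m ∧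
      u ≫ d = D.eStar ≫ q ∧ u ≫ t = D.e ≫ p := by
  have hd : Mono d := mono_of_isComplement hc
  have hk : Mono k := mono_of_isComplement_right hc
  have hs : Mono s := Adhesive.mono_of_isPushout_of_mono_right hp
  have hb : Mono b := by subst hbp; exact mono_of_mono b p
  have hpb := IsPullback.of_hasPullback p t
  set e := pullback.fst p t
  set u := pullback.snd p t
  have hu : Mono u := hpb.mono_snd_of_mono
  have w : (r.o ≫ b) ≫ p = k ≫ t := by simpa [hbp] using hp.w
  let k₀ := hpb.lift _ _ w
  have hk₀ : k₀ ≫ u = k := hpb.lift_snd _ _ _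
  have hpo : IsPushout r.o k₀ b e := isPushout_restrict hp hk₀ hbp hpb
  let D : DaggerDerivation r b :=
    ⟨hb, _, k₀, e, hpo, _, _, _, IsPushout.of_hasPushout r.i k₀⟩
  have wq : r.i ≫ m = k₀ ≫ u ≫ d := by rw [reassoc_of% hk₀, hc.isFPC.isPullback.w]
  -- Hence the pushout of `I` and the part `D.K'` of `K'` inside `B` is a subobject of `X`.
  have hpbi : IsPullback r.i k₀ m (u ≫ d) := by
    refine .mk' wq (fun _ _ _ h₁ _ => (cancel_mono r.i).1 h₁) fun _ a b hab => ?_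
    obtain ⟨l, hl₁, hl₂⟩ := hc.isFPC.isPullback.exists_lift a (b ≫ u) (by simpa using hab)
    exact ⟨l, hl₁, by rw [← cancel_mono u, Category.assoc, hk₀, hl₂]⟩
  refine ⟨D, D.pushout.desc m (u ≫ d) wq, u, ?_, D.pushout.inl_desc _ _ _,
    (D.pushout.inr_desc _ _ _).symm, hpb.w.symm⟩
  exact mono_of_isPushout_of_isPullback D.pushout hpbi (D.pushout.inl_desc _ _ _)
    (D.pushout.inr_desc _ _ _)

/-! ### Satisfaction of shifted and transported conditions -/

namespace Condition

theorem sat_disj {X Y : C} {ι : Type (max u v)} {c : ι → Condition X} {m : X ⟶ Y} :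
    (disj c).Sat m ↔ ∃ i, (c i).Sat m := by
  simp [disj, Sat]

theorem sat_and {X Y : C} {c c' : Condition X} {m : X ⟶ Y} :
    (c.and c').Sat m ↔ c.Sat m ∧ c'.Sat m := by
  simp [Condition.and, Sat, and_comm]

theorem sat_shift [Adhesive C] {A : C} (c : Condition A) {B Y : C} (a : A ⟶ B) (m : B ⟶ Y)
    [Mono m] : (c.shift a).Sat m ↔ c.Sat (a ≫ m) := by
  induction c generalizing B Y with
  | true => simp [shift, Sat]
  | neg c ih => simp [shift, Sat, ih]
  | conj c ih => simp [shift, Sat, ih]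
  | ex b hb c ih =>
    simp only [shift, sat_disj, Sat]
    constructor
    · rintro ⟨s, q, hq, hqm, h⟩
      have := s.mono_b₁
      have := Adhesive.mono_of_isPushout_of_mono_left s.pushout
      refine ⟨s.e₂ ≫ q, inferInstance, ?_, (ih s.e₂ q).1 h⟩
      have w : (s.δ ≫ s.b₁) ≫ s.e₁ = (s.δ ≫ s.b₂) ≫ s.e₂ := by
        simp only [Category.assoc, s.pushout.w]
      rw [s.δ_b₁, s.δ_b₂] at w
      rw [← hqm, reassoc_of% w]
    · rintro ⟨q, hq, hqm, h⟩
      -- The overlap is the intersection of the images of `m` and `q` in `Y`.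
      have hpb := IsPullback.of_hasPullback m q
      have hpo := IsPushout.of_hasPushout (pullback.fst m q) (pullback.snd m q)
      let s : ShiftIndex a b :=
        ⟨_, hpb.lift a b hqm.symm, _, _, inferInstance, inferInstance, hpb.lift_fst _ _ _,
          hpb.lift_snd _ _ _, _, _, _, hpo⟩
      have hs : Mono (hpo.desc m q hpb.w) :=
        mono_of_isPushout_of_isPullback hpo hpb (hpo.inl_desc _ _ _) (hpo.inr_desc _ _ _)
      refine ⟨s, hpo.desc m q hpb.w, hs, hpo.inl_desc _ _ _, (ih _ _).2 ?_⟩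
      rwa [hpo.inr_desc]

/-- A match satisfies the transport of a condition if and only if the comatch satisfies the
condition: monos into `X` and into `Y` that extend the match and the comatch correspond to each
other through the `DPO†`-type derivations of `r`. -/
theorem sat_trans [Adhesive C] [HasPullbacks C] {O : C} (c : Condition O) {T : Semantics}
    {I X Y K' : C} (r : Rule O I) {m : I ⟶ X} [Mono m] {k : r.K ⟶ K'} {d : K' ⟶ X} {s : O ⟶ Y}
    {t : K' ⟶ Y} (hc : IsComplement T r.i m k d) (hp : IsPushout r.o k s t) :
    (c.trans r).Sat m ↔ c.Sat s := by
  induction c generalizing I X Y K' with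
  | true => simp [trans, Sat]
  | neg c ih => simp only [trans, Sat, ih r hc hp]
  | conj c ih => simp only [trans, Sat, fun i => ih i r hc hp]
  | ex b hb c ih =>
    simp only [trans, sat_disj, Sat]
    constructor
    · rintro ⟨D, q, hq, rfl, h⟩
      obtain ⟨u, p, hpm, -, hbp, hcu, hpu⟩ := D.exists_extension hc hp
      exact ⟨p, hpm, hbp, (ih D.bottom hcu hpu).1 h⟩
    · rintro ⟨p, hpm, hbp, h⟩
      obtain ⟨D, q, u, hq, rfl, hu, hut⟩ := exists_daggerDerivation r hc hp b p hbp
      obtain ⟨u', p', -, hu', hbp', hcu, hpu⟩ := D.exists_extension hc hp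
      have hd : Mono d := mono_of_isComplement hc
      -- `D.exists_extension` recovers `p`, as both extensions agree on `O` and on `D.K'`.
      have huu : u' = u := by rw [← cancel_mono d, hu, hu']
      have hpp : p' = p := D.complement.hom_ext (by rw [hbp, hbp']) (by rw [hpu.w, huu, hut])
      subst hpp
      exact ⟨D, q, hq, rfl, (ih D.bottom hcu hpu).2 h⟩

end Condition

/-! ### Sequential independence and factorizations -/

/-- Both sequential independence and the existence of a factorization are instances of this
criterion: a map into the complement amounts to a lift of the overlap to the interface `K`. -/
theorem IsFPC.exists_factor_iff {K I K' X M O : C} {c : K ⟶ I} {m : I ⟶ X} {k : K ⟶ K'}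
    {d : K' ⟶ X} (h : IsFPC c m k d) {μ : M ⟶ I} {μ' : M ⟶ O} {s : O ⟶ X}
    (hM : IsPullback μ μ' m s) : (∃ n : O ⟶ K', n ≫ d = s) ↔ ∃ a : M ⟶ K, a ≫ c = μ := by
  constructor
  · rintro ⟨n, rfl⟩
    exact ⟨h.isPullback.lift μ (μ' ≫ n) (by simpa using hM.w), h.isPullback.lift_fst _ _ _⟩
  · intro ha
    exact (h.final μ μ' s hM ha).exists

/-- The input `I₂₁` of the composite rule is the union of `I₁` and `I₂` along `M`. -/
theorem CompositeDiagram.Factorization.isPushout [Adhesive C] {T : Semantics}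
    {O₁ I₁ O₂ I₂ M : C} {r₁ : Rule O₁ I₁} {r₂ : Rule O₂ I₂} {μ₂ : M ⟶ I₂} {μ₁ : M ⟶ O₁} [Mono μ₂]
    {Δ : CompositeDiagram T r₂ r₁ μ₂ μ₁}
    (f : Δ.Factorization) {a₁ : M ⟶ r₁.K} (ha₁ : a₁ ≫ r₁.o = μ₁) :
    IsPushout (a₁ ≫ r₁.i) μ₂ Δ.right.nStar (f.j₂ ≫ Δ.right.eStar) := by
  have : Mono Δ.right.e := Δ.right.bottom.mono_o
  -- `I₂` and `K₁` cover the complement of `O₁` in `N`, as `N` is covered by `I₂` and `O₁`.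
  have h : IsPushout μ₂ a₁ f.j₂ Δ.right.k := isPushout_restrict Δ.pushout ha₁ f.fac₂
    (Adhesive.isPullback_of_isPushout_of_mono_left Δ.right.complement).flip
  exact h.flip.paste_horiz Δ.right.pushout

variable [Adhesive C] [HasPullbacks C] {T : Semantics} {O₁ I₁ O₂ I₂ M : C} {r₁ : Rule O₁ I₁}
  {r₂ : Rule O₂ I₂} {μ₂ : M ⟶ I₂} {μ₁ : M ⟶ O₁}

/-- Sequential independence depends only on the overlap `M` of the two applications. -/
theorem seqIndependent_iff {X₀ : C} {m₁ : I₁ ⟶ X₀} {D₁ : DirectDerivation T r₁ m₁}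
    {m₂ : I₂ ⟶ D₁.Y} {D₂ : DirectDerivation T r₂ m₂} (hM : IsPullback μ₂ μ₁ m₂ D₁.mStar) :
    SeqIndependent D₁ D₂ ↔
      (∃ a₂ : M ⟶ r₂.K, a₂ ≫ r₂.i = μ₂) ∧ ∃ a₁ : M ⟶ r₁.K, a₁ ≫ r₁.o = μ₁ := by
  rw [← D₂.complement.isFPC.exists_factor_iff hM,
    ← (isFPC_of_isPushout D₁.pushout).exists_factor_iff hM.flip]
  have h₁ := D₁.mono_mStar
  have h₂ := D₂.mono_m
  constructor
  · rintro ⟨n₁, n₂, -, -, h, h'⟩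
    exact ⟨⟨n₁, h⟩, n₂, h'⟩
  · rintro ⟨⟨n₁, h⟩, n₂, h'⟩
    exact ⟨n₁, n₂, mono_of_mono_fac h, mono_of_mono_fac h', h, h'⟩

namespace CompositeDiagram

theorem nonempty_factorization_iff [Mono μ₂] (Δ : CompositeDiagram T r₂ r₁ μ₂ μ₁) :
    Nonempty Δ.Factorization ↔
      (∃ a₂ : M ⟶ r₂.K, a₂ ≫ r₂.i = μ₂) ∧ ∃ a₁ : M ⟶ r₁.K, a₁ ≫ r₁.o = μ₁ := by
  have hM := Adhesive.isPullback_of_isPushout_of_mono_left Δ.pushout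
  rw [← Δ.left.complement.isFPC.exists_factor_iff hM,
    ← (isFPC_of_isPushout Δ.right.complement).exists_factor_iff hM.flip]
  have h₁ := Δ.right.mono_n
  have h₂ := Δ.left.mono_m
  constructor
  · rintro ⟨f⟩
    exact ⟨⟨f.j₁, f.fac₁⟩, f.j₂, f.fac₂⟩
  · rintro ⟨⟨n₁, h⟩, n₂, h'⟩
    exact ⟨⟨n₁, n₂, mono_of_mono_fac h, mono_of_mono_fac h', h, h'⟩⟩

end CompositeDiagram

/-- The composite diagram is cut out of the two applications by restriction to the union `N` of
`I₂` and `O₁` in the intermediate object. -/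
theorem nonempty_compositeDiagram {X₀ : C} {m₁ : I₁ ⟶ X₀} (D₁ : DirectDerivation T r₁ m₁)
    {m₂ : I₂ ⟶ D₁.Y} (D₂ : DirectDerivation T r₂ m₂) (hM : IsPullback μ₂ μ₁ m₂ D₁.mStar) :
    Nonempty (CompositeDiagram T r₂ r₁ μ₂ μ₁) := by
  have := D₁.mono_mStar
  have := D₂.mono_m
  have : Mono μ₂ := hM.mono_fst_of_mono
  have : Mono μ₁ := hM.mono_snd_of_mono
  have hN := IsPushout.of_hasPushout μ₂ μ₁
  have : Mono (pushout.inl μ₂ μ₁) := Adhesive.mono_of_isPushout_of_mono_right hN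
  have : Mono (pushout.inr μ₂ μ₁) := Adhesive.mono_of_isPushout_of_mono_left hN
  obtain ⟨q, hq₂, hq₁⟩ := hN.exists_desc m₂ D₁.mStar hM.w
  have : Mono q := mono_of_isPushout_of_isPullback hN hM hq₂ hq₁
  have hc : IsComplement T r₂.i (pushout.inl μ₂ μ₁ ≫ q) D₂.k D₂.d := by
    rw [hq₂]; exact D₂.complement
  have hp : IsComplement .DPO r₁.o (pushout.inr μ₂ μ₁ ≫ q) D₁.k D₁.dStar := by
    rw [hq₁]; exact D₁.pushout
  obtain ⟨_, _, _, _, -, -, hc⟩ := hc.exists_restrict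
  obtain ⟨_, _, _, _, -, -, hp⟩ := hp.exists_restrict
  obtain ⟨L⟩ := nonempty_directDerivation r₂ hc
  obtain ⟨R⟩ := nonempty_daggerDerivation r₁ hp
  exact ⟨⟨_, _, _, hN, L, R⟩⟩

namespace CompositeDiagram

/-! ### The opposite composite -/

theorem nonempty_opposite [Mono μ₂] [Mono μ₁] (Δ : CompositeDiagram T r₂ r₁ μ₂ μ₁)
    (f : Δ.Factorization) : Nonempty (Δ.Opposite f) := by
  obtain ⟨⟨a₂, ha₂⟩, a₁, ha₁⟩ := Δ.nonempty_factorization_iff.1 ⟨f⟩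
  have : Mono a₁ := mono_of_mono_fac ha₁
  have : Mono a₂ := mono_of_mono_fac ha₂
  -- The complement of `O₂` in the union of `I₁` and `O₂` is the union of `I₁` and `K₂`.
  have hP := IsPushout.of_hasPushout (a₁ ≫ r₁.i) a₂
  set α := pushout.inl (a₁ ≫ r₁.i) a₂
  set β := pushout.inr (a₁ ≫ r₁.i) a₂
  have hPN := IsPushout.of_hasPushout r₂.o β
  have hN := hP.paste_vert hPN.flip
  have hPX := IsPushout.of_hasPushout r₂.i β
  have hX := hP.paste_vert hPX.flip
  rw [ha₂] at hX
  -- The complement of `I₁` in this union is the union of `K₁` and `O₂`.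
  have hQ := IsPushout.of_hasPushout a₁ (a₂ ≫ r₂.o)
  obtain ⟨e, he₁, he₂⟩ := hQ.exists_desc (r₁.i ≫ α ≫ pushout.inr r₂.o β) (pushout.inl r₂.o β)
    (by simpa using hN.w)
  have hQN : IsPushout r₁.i (pushout.inl a₁ (a₂ ≫ r₂.o)) (α ≫ pushout.inr r₂.o β) e :=
    .of_left (by rwa [he₂]) he₁.symm hQ
  have : Mono (α ≫ pushout.inr r₂.o β) := Adhesive.mono_of_isPushout_of_mono_right hN
  have : Mono (pushout.inl r₂.o β) := Adhesive.mono_of_isPushout_of_mono_left hN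
  obtain ⟨L⟩ := nonempty_directDerivation (T := T) r₁ (isComplement_of_isPushout hQN)
  let Δ' : CompositeDiagram T r₁ r₂ (a₁ ≫ r₁.i) (a₂ ≫ r₂.o) :=
    ⟨_, _, _, hN, L, ⟨inferInstance, _, _, _, hPN, _, _, _, hPX⟩⟩
  exact ⟨⟨a₁, a₂, ha₁, ha₂, Δ', α, rfl, hX.isoIsPushout _ _ (f.isPushout ha₁),
    hX.inl_isoIsPushout_hom _ _ (f.isPushout ha₁), hX.inr_isoIsPushout_hom _ _ (f.isPushout ha₁)⟩⟩

/-! ### Applications of the composite rule and two-step applications -/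

/-- The composite condition at `m` consists of the two original conditions, at the restriction of
`m` to `I₁` and at the restriction to `I₂` of the comatch `p`. -/
theorem sat_condition (Δ : CompositeDiagram T r₂ r₁ μ₂ μ₁) {X Y K' : C} {m : Δ.right.X ⟶ X}
    [Mono m] {u : Δ.right.K' ⟶ K'} {d : K' ⟶ X} {p : Δ.N ⟶ Y} {t : K' ⟶ Y} [Mono p]
    (hc : IsComplement T Δ.right.eStar m u d) (hp : IsPushout Δ.right.e u p t)
    (c₂ : Condition I₂) (c₁ : Condition I₁) :
    (Δ.condition c₂ c₁).Sat m ↔ c₁.Sat (Δ.right.nStar ≫ m) ∧ c₂.Sat (Δ.n₂ ≫ p) := by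
  rw [condition, Condition.sat_and, Condition.sat_shift,
    Condition.sat_trans _ Δ.right.bottom hc hp, Condition.sat_shift]

/-- A match of the composite rule which restricts to the matches of a two-step application is
admissible, and it satisfies the composite condition if and only if these matches satisfy the
conditions of the two rules. -/
theorem admissible_and_sat_condition_iff (Δ : CompositeDiagram T r₂ r₁ μ₂ μ₁) {Y : C}
    {m : Δ.right.X ⟶ Y} [Mono m] {m₁ : I₁ ⟶ Y} (D₁ : DirectDerivation T r₁ m₁) {m₂ : I₂ ⟶ D₁.Y}
    (D₂ : DirectDerivation T r₂ m₂) (hm₁ : Δ.right.nStar ≫ m = m₁) {j : I₂ ⟶ Δ.right.K'}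
    (hj : j ≫ Δ.right.e = Δ.n₂) {n : I₂ ⟶ D₁.K'} (hn : n ≫ D₁.dStar = m₂)
    (hn' : n ≫ D₁.d = j ≫ Δ.right.eStar ≫ m) :
    Δ.Admissible m ∧ ∀ (c₂ : Condition I₂) (c₁ : Condition I₁),
      (Δ.condition c₂ c₁).Sat m ↔ c₁.Sat m₁ ∧ c₂.Sat m₂ := by
  subst hm₁
  obtain ⟨u, p, hpm, hu, -, hc, hp⟩ := Δ.right.exists_extension D₁.complement D₁.pushout
  have := D₁.mono_d
  have hjn : j ≫ u = n := by rw [← cancel_mono D₁.d, Category.assoc, hu, hn']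
  have hm₂ : Δ.n₂ ≫ p = m₂ := by rw [← hj, Category.assoc, hp.w, reassoc_of% hjn, hn]
  subst hm₂
  refine ⟨⟨⟨inferInstance, _, u, _, hc, _, p, _, hp⟩, ?_⟩, Δ.sat_condition hc hp⟩
  have := Δ.left.mono_m
  obtain ⟨_, -, -, hc₂⟩ := D₂.complement.exists_cancel Δ.left.complement
  exact nonempty_directDerivation _ hc₂

/-- An application of the composite rule is a two-step application of the given rules. -/
theorem Admissible.exists_derivations {Δ : CompositeDiagram T r₂ r₁ μ₂ μ₁} {Y : C}
    {m : Δ.right.X ⟶ Y} (h : Δ.Admissible m) :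
    ∃ (D₁ : DirectDerivation T r₁ (Δ.right.nStar ≫ m)) (p : Δ.N ⟶ D₁.Y)
      (_ : DirectDerivation T r₂ (Δ.n₂ ≫ p)) (u : Δ.right.K' ⟶ D₁.K'), Mono m ∧ Mono p ∧
        Δ.n₁ ≫ p = D₁.mStar ∧ u ≫ D₁.d = Δ.right.eStar ≫ m ∧ u ≫ D₁.dStar = Δ.right.e ≫ p := by
  obtain ⟨E, ⟨E'⟩⟩ := h
  have := E.mono_m
  have := E'.mono_m
  have := Δ.right.mono_nStar
  have := Δ.left.mono_m
  let D₁ : DirectDerivation T r₁ (Δ.right.nStar ≫ m) :=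
    ⟨inferInstance, E.K', _, E.d, (isComplement_of_isPushout Δ.right.pushout).paste E.complement,
      E.Y, _, E.dStar, Δ.right.complement.paste_vert E.pushout⟩
  let D₂ : DirectDerivation T r₂ (Δ.n₂ ≫ E.mStar) :=
    ⟨inferInstance, _, _, _, Δ.left.complement.paste E'.complement, _, _, _,
      Δ.left.pushout.paste_vert E'.pushout⟩
  exact ⟨D₁, E.mStar, D₂, E.k, E.mono_m, E'.mono_m, rfl, E.complement.isFPC.isPullback.w.symm,
    E.pushout.w.symm⟩

/-! ### Compatibility of the conditions -/

/-- Compatibility with switching is equivalence of the composite conditions, since the admissible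
matches of both composites are the starting points of the switchable two-step applications. -/
theorem conditionsSwitch_iff [Mono μ₂] (Δ : CompositeDiagram T r₂ r₁ μ₂ μ₁)
    {f : Δ.Factorization} (S : Δ.Opposite f) (c₁ : Condition I₁) (c₂ : Condition I₂) :
    ConditionsSwitch T r₁ c₁ r₂ c₂ μ₂ μ₁ ↔ Δ.ConditionsEquivalent S c₂ c₁ := by
  constructor
  · intro h Y m hA hA'
    obtain ⟨D₁, p, D₂, u, hm, hp, hp₁, hu, hu'⟩ := hA.exists_derivations
    obtain ⟨F₂, p', F₁, w, hm', -, -, hw, hw'⟩ := hA'.exists_derivations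
    have hM : IsPullback μ₂ μ₁ (Δ.n₂ ≫ p) D₁.mStar := by
      rw [← hp₁, isPullback_comp_mono_iff]
      exact Adhesive.isPullback_of_isPushout_of_mono_left Δ.pushout
    have e₁ : S.j ≫ S.Δ'.right.eStar ≫ S.φ.hom ≫ m = Δ.right.nStar ≫ m := by simp [← S.φ_I₁]
    have e₂ : S.Δ'.right.nStar ≫ S.φ.hom ≫ m = f.j₂ ≫ Δ.right.eStar ≫ m := by
      rw [reassoc_of% S.φ_I₂]
    have g₂ : (f.j₂ ≫ u) ≫ D₁.dStar = Δ.n₂ ≫ p := by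
      rw [Category.assoc, hu', reassoc_of% f.fac₂]
    have g₂' : (f.j₂ ≫ u) ≫ D₁.d = f.j₂ ≫ Δ.right.eStar ≫ m := by rw [Category.assoc, hu]
    have g₁ : (S.j ≫ w) ≫ F₂.dStar = S.Δ'.n₂ ≫ p' := by
      rw [Category.assoc, hw', reassoc_of% S.fac]
    have g₁' : (S.j ≫ w) ≫ F₂.d = S.j ≫ S.Δ'.right.eStar ≫ S.φ.hom ≫ m := by
      rw [Category.assoc, hw]
    rw [(Δ.admissible_and_sat_condition_iff D₁ D₂ rfl f.fac₂ g₂ g₂').2,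
      (S.Δ'.admissible_and_sat_condition_iff F₂ F₁ rfl S.fac g₁ g₁').2]
    exact h Y _ D₁ _ D₂ hM _ F₂ _ F₁ ⟨⟨_, g₂, g₂'.trans e₂.symm⟩, _, g₁'.trans e₁, g₁⟩
  · rintro h Y m₁ D₁ m₂ D₂ hM m₂' F₂ m₁' F₁ ⟨⟨n₂, hn₂, hn₂'⟩, n₁, hn₁, hn₁'⟩
    -- `I₁` and `I₂` meet in `Y` exactly in `M`, hence their union `I₂₁` is a subobject `m` of `Y`.
    have hI : IsPullback (S.a₁ ≫ r₁.i) μ₂ m₁ m₂' := by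
      have hK : IsPullback S.a₁ μ₂ D₁.k n₂ := by
        refine .of_right (h₁₂ := r₁.o) (h₂₂ := D₁.dStar) (v₁₃ := D₁.mStar) ?_ ?_
          (Adhesive.isPullback_of_isPushout_of_mono_left D₁.pushout)
        · rw [S.a₁_o, hn₂]
          exact hM.flip
        · have : Mono D₁.dStar := D₁.bottom.mono_o
          rw [← cancel_mono D₁.dStar, Category.assoc, ← D₁.pushout.w, reassoc_of% S.a₁_o,
            Category.assoc, hn₂, hM.w]
      rw [← hn₂']
      exact hK.paste_horiz D₁.complement.isFPC.isPullback
    obtain ⟨m, h₁, h₂⟩ := (f.isPushout S.a₁_o).exists_desc m₁ m₂' hI.w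
    have := D₁.mono_m
    have := F₂.mono_m
    have : Mono m := mono_of_isPushout_of_isPullback (f.isPushout S.a₁_o) hI h₁ h₂
    have h₂' : n₂ ≫ D₁.d = f.j₂ ≫ Δ.right.eStar ≫ m := by rw [hn₂', ← h₂, Category.assoc]
    have h₁' : n₁ ≫ F₂.d = S.j ≫ S.Δ'.right.eStar ≫ S.φ.hom ≫ m := by
      rw [hn₁, ← h₁, ← S.φ_I₁]
      simp only [Category.assoc]
    have h₃ : S.Δ'.right.nStar ≫ S.φ.hom ≫ m = m₂' := by
      rw [reassoc_of% S.φ_I₂, ← h₂, Category.assoc]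
    obtain ⟨hA, hs⟩ := Δ.admissible_and_sat_condition_iff D₁ D₂ h₁ f.fac₂ hn₂ h₂'
    obtain ⟨hA', hs'⟩ := S.Δ'.admissible_and_sat_condition_iff F₂ F₁ h₃ S.fac hn₁' h₁'
    rw [← hs, ← hs']
    exact h Y m hA hA'

end CompositeDiagram

end Rewriting

theorem mainTheorem5 (C : Type u) [Category.{v} C] [Adhesive C] [HasPullbacks C] [HasInitial C]
    [HasStrictInitialObjects C] (hfact : HasEpiMonoFactorization C) (hfin : IsFinitary C)
    (T : Semantics) {O₁ I₁ O₂ I₂ : C} (r₁ : Rule O₁ I₁) (r₂ : Rule O₂ I₂)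
    {X₀ : C} (m₁ : I₁ ⟶ X₀) (D₁ : DirectDerivation T r₁ m₁)
    (m₂ : I₂ ⟶ D₁.Y) (D₂ : DirectDerivation T r₂ m₂)
    {M : C} (μ₂ : M ⟶ I₂) (μ₁ : M ⟶ O₁) (hM : IsPullback μ₂ μ₁ m₂ D₁.mStar) :
    Nonempty (CompositeDiagram T r₂ r₁ μ₂ μ₁) ∧
    ∀ Δ : CompositeDiagram T r₂ r₁ μ₂ μ₁,
      (SeqIndependent D₁ D₂ ↔ Nonempty Δ.Factorization) ∧
      (∀ f : Δ.Factorization, Nonempty (Δ.Opposite f)) ∧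
      (∀ (c₁ : Condition I₁) (c₂ : Condition I₂),
        (SeqIndependent D₁ D₂ ∧ ConditionsSwitch T r₁ c₁ r₂ c₂ μ₂ μ₁) ↔
          ∃ f : Δ.Factorization, ∀ S : Δ.Opposite f, Δ.ConditionsEquivalent S c₂ c₁) := by
  have := D₁.mono_mStar
  have := D₂.mono_m
  have : Mono μ₂ := hM.mono_fst_of_mono
  have : Mono μ₁ := hM.mono_snd_of_mono
  refine ⟨nonempty_compositeDiagram D₁ D₂ hM, fun Δ => ?_⟩
  have hind : SeqIndependent D₁ D₂ ↔ Nonempty Δ.Factorization := by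
    rw [seqIndependent_iff hM, Δ.nonempty_factorization_iff]
  refine ⟨hind, Δ.nonempty_opposite, fun c₁ c₂ => ⟨?_, ?_⟩⟩
  · rintro ⟨hi, hc⟩
    obtain ⟨f⟩ := hind.1 hi
    exact ⟨f, fun S => (Δ.conditionsSwitch_iff S c₁ c₂).1 hc⟩
  · rintro ⟨f, hf⟩
    obtain ⟨S⟩ := Δ.nonempty_opposite f
    exact ⟨hind.2 ⟨f⟩, (Δ.conditionsSwitch_iff S c₁ c₂).2 (hf S)⟩
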